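/- **Convergence of randomized subvector selection.** Let $\mathcal S_1,\dots,\mathcal S_d$ be pairwise disjoint sets with union $\{1,\dots,p\}$. For $v\in\mathbb R^p$ let $v^{(j)}$ be the vector obtained from $v$ by replacing the coordinates outside $\mathcal S_j$ by $0$. On a probability space $(\Omega,\mathcal F,P)$ let $j_0,j_1,\dots$ be independent random variables with $P(j_k=j)=q(j)>0$, $\sum_{j=1}^d q(j)=1$. Given deterministic sequences $\{a^{(j)}_k\}_{k\ge0}$, let $\tilde a^{(j)}_k=a^{(j)}_{N}$ with $N=\#\{r<k: j_r=j\}$ (the first unused element of the $j$th sequence), and let the iterates be $$\hat\theta_{k+1}=\hat\theta_k-\tilde a_k^{(j_k)}\,\hat g_k^{(j_k)}(\hat\theta_k),\qquad \hat g_k(\hat\theta_k)=g(\hat\theta_k)+\beta_k(\hat\theta_k)+\xi_k(\hat\theta_k),$$ where $g:\mathbb R^p\to\mathbb R^p$ (for example the gradient of a loss function) and $\hat g_k,\beta_k,\xi_k$ are random vector fields (gradient estimate, bias and noise). Assume: * **A0′.** $a_k>0$ and $a_k^{(j)}>0$ are strictly decreasing in $k$, $\sum_k a_k=\infty$, $\sum_k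 a_k^2<\infty$, and $a^{(j)}_k\to0$. For each $j$ there are a function $\rho(j,\cdot):[0,1]\to\mathbb R$ and a constant $C<\infty$ such that for all sufficiently small $\varepsilon>0$ $$\lim_{k\to\infty}\frac{a^{(j)}_{\lfloor k(q(j)-\varepsilon)\rfloor}}{a_k}=\rho(j,q(j)-\varepsilon),\qquad \lim_{k\to\infty}\frac{a^{(j)}_{\lceil k(q(j)+\varepsilon)\rceil}}{a_k}=\rho(j,q(j)+\varepsilon),$$ $0<\rho(j,q(j)\pm\varepsilon)<C$ and $\rho(j,q(j)+\varepsilon)\le\rho(j,q(j))\le\rho(j,q(j)-\varepsilon)$, where requirements involving $q(j)+\varepsilon$ are imposed only if $q(j)+\varepsilon\le1$; moreover $\rho(j,\cdot)$ is continuous at $q(j)$ relative to $[0,1]$, $0<\rho(j,q(j))<\infty$, and for some $\varepsilon>0$ with $q(j)-\varepsilon>0$ one has $e^{-2\varepsilon^2k}/a_k\to0$. * **A3′.** $g$ is continuous. * **A4′.** With probability 1 the sequence $\{\hat\theta_k\}_{k\ge0}$ is bounded (by a bound that may depend on $\omega$). * **A5′.** With probability 1 the sequence $\{\beta_k^{(j_k)}(\hat\theta_k)\}_{k\ge0}$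 is bounded and converges to $0$. * **A6′.** With $D_r=(\tilde a_r^{(j_r)}/a_r)\,\xi_r^{(j_r)}(\hat\theta_r)$, for every $\varepsilon>0$, $\lim_{k\to\infty}P\big(\sup_{m\ge k}\|\sum_{r=k}^m a_rD_r\|\ge\varepsilon\big)=0$. * **A7′.** $\theta^*$ is a locally asymptotically stable (in the sense of Lyapunov) solution of $\dot Z(t)=-\sum_{j=1}^d q(j)\rho(j,q(j))\,g^{(j)}(Z(t))=-\Lambda g(Z(t))$, where $\Lambda$ is the diagonal matrix with $\Lambda_{ii}=q(j)\rho(j,q(j))$ for $i\in\mathcal S_j$. Let $DA(\theta^*)$ be its domain of attraction, that is, the set of initial points from which a solution on $[0,\infty)$ exists and from which every such solution converges to $\theta^*$. * **A8′.** There is a compact set $A\subset DA(\theta^*)$ such that with probability 1, $\hat\theta_k\in A$ for infinitely many $k$. Then $\hat\theta_k\to\theta^*$ with probability 1. -/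

import Mathlib

open MeasureTheory ProbabilityTheory Filter Topology

namespace RandomizedSA

/-- The vector `v^{(j)}` attached to an index set `S`: the coordinates of `v` outside `S` are
replaced by zero. -/
noncomputable def subvec {p : ℕ} (S : Finset (Fin p)) (v : EuclideanSpace ℝ (Fin p)) :
    EuclideanSpace ℝ (Fin p) :=
  WithLp.toLp 2 (fun i => if i ∈ S then v i else 0)

/-- The number of iterations `r < k` in which the subvector `i` was selected. -/
def usageCount {Ω : Type*} {d : ℕ} (sel : ℕ → Ω → Fin d) (i : Fin d) (k : ℕ) (ω : Ω) : ℕ :=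
  ((Finset.range k).filter (fun r => sel r ω = i)).card

/-- The queued gain `ã_k^{(i)}`: the first element of the sequence `a^{(i)}` that has not been used
before iteration `k`. An element is used up exactly when subvector `i` is selected. -/
def queuedGain {Ω : Type*} {d : ℕ} (aj : Fin d → ℕ → ℝ) (sel : ℕ → Ω → Fin d)
    (i : Fin d) (k : ℕ) (ω : Ω) : ℝ :=
  aj i (usageCount sel i k ω)

/-- The iterates of randomized subvector selection:
`θ_{k+1} = θ_k - ã_k^{(j_k)} ĝ_k^{(j_k)}(θ_k)`, where `j_k = sel k ω` is the selected index and
`ghat k ω` is the (random) gradient estimate of iteration `k`. -/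
noncomputable def iter {Ω : Type*} {p d : ℕ} (S : Fin d → Finset (Fin p))
    (aj : Fin d → ℕ → ℝ) (sel : ℕ → Ω → Fin d)
    (ghat : ℕ → Ω → EuclideanSpace ℝ (Fin p) → EuclideanSpace ℝ (Fin p))
    (θ₀ : Ω → EuclideanSpace ℝ (Fin p)) : ℕ → Ω → EuclideanSpace ℝ (Fin p)
  | 0, ω => θ₀ ω
  | k + 1, ω =>
      iter S aj sel ghat θ₀ k ω -
        queuedGain aj sel (sel k ω) k ω •
          subvec (S (sel k ω)) (ghat k ω (iter S aj sel ghat θ₀ k ω))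

/-- The conditions that relate one gain sequence `b = a^{(j)}` (with selection probability
`q = q(j)`) to the reference sequence `a`, through the function `ρ = ρ(j, ·)` on `[0, 1]`.
All requirements at `q ± ε` are for all sufficiently small `ε > 0` with `q ± ε ∈ [0, 1]`. -/
structure GainCondition (q : ℝ) (a b : ℕ → ℝ) (ρ : ℝ → ℝ) : Prop where
  pos : ∀ k, 0 < b k
  strictAnti : StrictAnti b
  tendsto_zero : Tendsto b atTop (𝓝 0)
  tendsto_left : ∀ᶠ ε in 𝓝[>] (0 : ℝ), 0 ≤ q - ε →
    Tendsto (fun k : ℕ => b ⌊(k : ℝ) * (q - ε)⌋₊ / a k) atTop (𝓝 (ρ (q - ε)))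
  tendsto_right : ∀ᶠ ε in 𝓝[>] (0 : ℝ), q + ε ≤ 1 →
    Tendsto (fun k : ℕ => b ⌈(k : ℝ) * (q + ε)⌉₊ / a k) atTop (𝓝 (ρ (q + ε)))
  bounds : ∃ C : ℝ, ∀ᶠ ε in 𝓝[>] (0 : ℝ),
    (0 ≤ q - ε → 0 < ρ (q - ε) ∧ ρ (q - ε) < C) ∧
    (q + ε ≤ 1 → 0 < ρ (q + ε) ∧ ρ (q + ε) < C)
  continuousWithinAt : ContinuousWithinAt ρ (Set.Icc 0 1) q
  order : ∀ᶠ ε in 𝓝[>] (0 : ℝ),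
    (0 ≤ q - ε → ρ q ≤ ρ (q - ε)) ∧ (q + ε ≤ 1 → ρ (q + ε) ≤ ρ q)
  limit_pos : 0 < ρ q
  exp_decay : ∃ ε : ℝ, 0 < ε ∧ 0 < q - ε ∧
    Tendsto (fun k : ℕ => Real.exp (-2 * ε ^ 2 * (k : ℝ)) / a k) atTop (𝓝 0)

/-- The diagonal matrix `Λ` with `Λ_ii = q(j) ρ(j, q(j))`, where `j` is the index with `i ∈ S_j`
(there is exactly one such `j` when the `S_j` form a partition). -/
noncomputable def gainMatrix {p d : ℕ} (S : Fin d → Finset (Fin p)) (q : Fin d → ℝ)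
    (ρ : Fin d → ℝ → ℝ) : Matrix (Fin p) (Fin p) ℝ :=
  Matrix.diagonal (fun i => ∑ j, if i ∈ S j then q j * ρ j (q j) else 0)

/-- The right-hand side `Z ↦ -Λ g(Z)` of the limiting ordinary differential equation. -/
noncomputable def limitField {p d : ℕ} (S : Fin d → Finset (Fin p)) (q : Fin d → ℝ)
    (ρ : Fin d → ℝ → ℝ) (g : EuclideanSpace ℝ (Fin p) → EuclideanSpace ℝ (Fin p))
    (Z : EuclideanSpace ℝ (Fin p)) : EuclideanSpace ℝ (Fin p) :=
  -(Matrix.toEuclideanLin (gainMatrix S q ρ) (g Z))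

/-- The two forms of the limiting field agree: `-Λ g(Z) = -∑_j q(j) ρ(j, q(j)) g^{(j)}(Z)`. -/
theorem limitField_eq_sum {p d : ℕ} (S : Fin d → Finset (Fin p)) (q : Fin d → ℝ)
    (ρ : Fin d → ℝ → ℝ) (g : EuclideanSpace ℝ (Fin p) → EuclideanSpace ℝ (Fin p))
    (Z : EuclideanSpace ℝ (Fin p)) :
    limitField S q ρ g Z = -∑ j, (q j * ρ j (q j)) • subvec (S j) (g Z) := by
  unfold limitField
  congr 1
  ext i
  simp [gainMatrix, subvec, Matrix.toLpLin_apply, Matrix.mulVec_diagonal, Finset.sum_mul]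

/-- The domain of attraction of `x` for `Z' = F(Z)`: the initial points from which the equation
has a solution on `[0, ∞)` and from which every such solution converges to `x`. -/
def domainOfAttraction {E : Type*} [NormedAddCommGroup E] [NormedSpace ℝ E] (F : E → E) (x : E) :
    Set E :=
  {z | (∃ Z : ℝ → E, Z 0 = z ∧ IsIntegralCurveOn Z (fun _ => F) (Set.Ici 0)) ∧
    ∀ Z : ℝ → E, Z 0 = z → IsIntegralCurveOn Z (fun _ => F) (Set.Ici 0) →
      Tendsto Z atTop (𝓝 x)}

/-- Stability in the sense of Lyapunov of the constant solution `x` of `Z' = F(Z)`. -/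
def LyapunovStable {E : Type*} [NormedAddCommGroup E] [NormedSpace ℝ E] (F : E → E) (x : E) :
    Prop :=
  F x = 0 ∧ ∀ ε > 0, ∃ δ > 0, ∀ (T : ℝ) (Z : ℝ → E),
    IsIntegralCurveOn Z (fun _ => F) (Set.Icc 0 T) → ‖Z 0 - x‖ < δ →
      ∀ t ∈ Set.Icc 0 T, ‖Z t - x‖ < ε

/-- Local asymptotic stability in the sense of Lyapunov: stability, and attraction of all solutions
that start in some neighbourhood of `x`. -/
def LocallyAsymptoticallyStable {E : Type*} [NormedAddCommGroup E] [NormedSpace ℝ E] (F : E → E)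
    (x : E) : Prop :=
  LyapunovStable F x ∧ domainOfAttraction F x ∈ 𝓝 x

end RandomizedSA

/-!
The proof is the ordinary differential equation method, carried out without uniqueness of
solutions, since the field is only continuous.

On the probabilistic side three facts are needed, each almost sure. By the strong law of large
numbers `usageCount sel j k ω / k` tends to `q j`, so by monotonicity of the gain sequences the
ratio of the queued gain to `a k` tends to `ρ j (q j)` (`GainCondition.tendsto_queue_ratio`). The
series `∑ a r (1[sel r = j] - q j)` converges, because its partial sums form an `L²`-bounded
martingale (`ae_block_sum_selection_small`). The noise series has small late blocks
(`ae_block_sum_small`). No martingale argument involves the iterates: these may depend on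
future selections, as the bias and noise fields are arbitrary.

Consequently, on almost every path the iterates form a perturbed Euler scheme
(`IsPerturbedEuler`, `isPerturbedEuler_of_selection`): while they stay near a point `z`, the
selected fields are nearly `ρ j (q j) g^{(j)}(z)`, and the selections average out to `-Λ g(z)`.

The rest is deterministic. Interpolated on the time scale `∑ a r`, the iterates are asymptotically
Lipschitz, so along any ultrafilter at infinity their shifts converge locally uniformly, and the
averaging property shows that the limit solves the differential equation
(`IsPerturbedEuler.hasDerivAt_limit`). Limits started at the visits to the compact set `A` are
attracted to the equilibrium, so the iterates come close to it. By the same compactness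
argument, stability and attraction near the equilibrium make the iterates return to a small ball
infinitely often without leaving a larger one in between
(`IsPerturbedEuler.tendsto_of_locallyAsymptoticallyStable`).
-/

namespace RandomizedSA

/-! ### The time scale of a gain sequence -/

/-- The time `∑_{r<n} a r` that has passed before iteration `n`. -/
def clock (a : ℕ → ℝ) (n : ℕ) : ℝ := ∑ r ∈ Finset.range n, a r

/-- The iteration that is current at time `s`: the index `n` with `clock a n ≤ s < clock a (n + 1)`
when `0 ≤ s`, and `0` when `s < 0`. -/
noncomputable def clockIndex (a : ℕ → ℝ) (s : ℝ) : ℕ := sInf {n | s < clock a (n + 1)}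

section Clock

variable {a : ℕ → ℝ}

theorem clock_strictMono (ha : ∀ k, 0 < a k) : StrictMono (clock a) :=
  strictMono_nat_of_lt_succ fun n => by simp [clock, Finset.sum_range_succ, ha n]

theorem clock_tendsto (ha : ∀ k, 0 < a k) (hs : ¬ Summable a) : Tendsto (clock a) atTop atTop :=
  (not_summable_iff_tendsto_nat_atTop_of_nonneg fun k => (ha k).le).1 hs

theorem sum_Ico_eq_clock_sub {n m : ℕ} (h : n ≤ m) :
    ∑ r ∈ Finset.Ico n m, a r = clock a m - clock a n :=
  Finset.sum_Ico_eq_sub a h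

theorem lt_clock_clockIndex_succ (ha : ∀ k, 0 < a k) (hs : ¬ Summable a) (s : ℝ) :
    s < clock a (clockIndex a s + 1) := by
  have hne : {n | s < clock a (n + 1)}.Nonempty := by
    obtain ⟨n, hn⟩ := ((clock_tendsto ha hs).comp (tendsto_add_atTop_nat 1)).eventually_gt_atTop s
      |>.exists
    exact ⟨n, hn⟩
  exact Nat.sInf_mem hne

theorem clock_clockIndex_le {s : ℝ} (h : 0 ≤ s) : clock a (clockIndex a s) ≤ s := by
  rcases hn : clockIndex a s with _ | n
  · simpa [clock] using h
  · by_contra! hlt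
    exact Nat.notMem_of_lt_sInf (s := {n | s < clock a (n + 1)}) (m := n)
      (by change n < clockIndex a s; omega) hlt

theorem clockIndex_clock (ha : ∀ k, 0 < a k) (hs : ¬ Summable a) (n : ℕ) :
    clockIndex a (clock a n) = n := by
  have hmono := clock_strictMono ha
  have h0 : 0 ≤ clock a n := Finset.sum_nonneg fun k _ => (ha k).le
  have h1 := hmono.lt_iff_lt.1 (lt_clock_clockIndex_succ ha hs (clock a n))
  have h2 := hmono.le_iff_le.1 (clock_clockIndex_le (a := a) h0)
  omega

theorem clockIndex_mono (ha : ∀ k, 0 < a k) (hs : ¬ Summable a) {s t : ℝ} (hst : s ≤ t) :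
    clockIndex a s ≤ clockIndex a t :=
  Nat.sInf_le (hst.trans_lt (lt_clock_clockIndex_succ ha hs t))

theorem tendsto_clockIndex (ha : ∀ k, 0 < a k) (hs : ¬ Summable a) :
    Tendsto (clockIndex a) atTop atTop := by
  refine tendsto_atTop_atTop.2 fun n => ⟨clock a n, fun s hsn => ?_⟩
  simpa [clockIndex_clock ha hs] using clockIndex_mono ha hs hsn

/-- The step of the discretized time scale vanishes asymptotically. -/
theorem tendsto_clock_clockIndex_sub (ha : ∀ k, 0 < a k) (hs : ¬ Summable a)
    (h0 : Tendsto a atTop (𝓝 0)) :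
    Tendsto (fun s => clock a (clockIndex a s) - s) atTop (𝓝 0) := by
  have h1 : Tendsto (fun s => -a (clockIndex a s)) atTop (𝓝 0) := by
    simpa using (h0.comp (tendsto_clockIndex ha hs)).neg
  refine tendsto_of_tendsto_of_tendsto_of_le_of_le' h1 tendsto_const_nhds
    (Eventually.of_forall fun s => ?_) ?_
  · have := lt_clock_clockIndex_succ ha hs s
    simp only [clock, Finset.sum_range_succ] at this ⊢
    linarith
  · filter_upwards [eventually_ge_atTop 0] with s hs0
    linarith [clock_clockIndex_le (a := a) hs0]

end Clock

/-! ### Limits of the shifted iterates solve the averaged equation -/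

variable {E : Type*} [NormedAddCommGroup E] [NormedSpace ℝ E]

/-- The sequence `x` is a bounded perturbed Euler scheme with step sizes `a` and increments `v`
for the averaged field `h`. The residuals of `x (k + 1) = x k + a k • v k` have small sums over late
blocks, and while the iterates stay near a point `z` the accumulated increments agree,
up to a small multiple of the elapsed time and an error that vanishes for late blocks, with those
of the constant field `h z`. -/
structure IsPerturbedEuler (a : ℕ → ℝ) (v x : ℕ → E) (h : E → E) : Prop where
  pos : ∀ k, 0 < a k
  not_summable : ¬ Summable a
  tendsto_zero : Tendsto a atTop (𝓝 0)
  bounded : ∃ R, ∀ k, ‖x k‖ ≤ R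
  bounded_increments : ∃ K, ∀ k, ‖v k‖ ≤ K
  residual : ∀ η > 0, ∃ N, ∀ n m, N ≤ n → n ≤ m →
    ‖x m - x n - ∑ r ∈ Finset.Ico n m, a r • v r‖ ≤ η
  averaging : ∀ z, ∀ ε > 0, ∃ δ > 0, ∀ η > 0, ∃ N, ∀ n m, N ≤ n → n ≤ m →
    (∀ r ∈ Finset.Ico n m, ‖x r - z‖ < δ) →
      ‖∑ r ∈ Finset.Ico n m, a r • v r - (clock a m - clock a n) • h z‖
        ≤ ε * (clock a m - clock a n) + η

namespace IsPerturbedEuler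

variable {a : ℕ → ℝ} {v x : ℕ → E} {h : E → E}

/-- The step interpolation of the iterates is asymptotically Lipschitz. -/
theorem exists_norm_interp_sub_le (H : IsPerturbedEuler a v x h) :
    ∃ K, 0 < K ∧ ∀ η > 0, ∃ s₀ : ℝ, ∀ s t, s₀ ≤ s → s₀ ≤ t →
      ‖x (clockIndex a t) - x (clockIndex a s)‖ ≤ K * |t - s| + η := by
  obtain ⟨K, hK⟩ := H.bounded_increments
  have hK0 : 0 ≤ K := (norm_nonneg _).trans (hK 0)
  refine ⟨K + 1, by linarith, fun η hη => ?_⟩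
  obtain ⟨N, hN⟩ := H.residual (η / 2) (by linarith)
  have hη' : 0 < η / (4 * (K + 1)) := by positivity
  have hev : ∀ᶠ s in atTop, N ≤ clockIndex a s ∧
      |clock a (clockIndex a s) - s| ≤ η / (4 * (K + 1)) := by
    refine ((tendsto_clockIndex H.pos H.not_summable).eventually_ge_atTop N).and ?_
    have := tendsto_clock_clockIndex_sub H.pos H.not_summable H.tendsto_zero
    filter_upwards [Metric.tendsto_nhds.1 this _ hη'] with s hs
    rw [dist_zero_right, Real.norm_eq_abs] at hs
    exact hs.le
  obtain ⟨s₀, hs₀⟩ := eventually_atTop.1 hev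
  have key : ∀ s t, s₀ ≤ s → s ≤ t →
      ‖x (clockIndex a t) - x (clockIndex a s)‖ ≤ (K + 1) * |t - s| + η := by
    intro s t hs hst
    have hle := clockIndex_mono H.pos H.not_summable hst
    have h1 := hN _ _ (hs₀ s hs).1 hle
    have h2 : ‖∑ r ∈ Finset.Ico (clockIndex a s) (clockIndex a t), a r • v r‖ ≤
        K * (clock a (clockIndex a t) - clock a (clockIndex a s)) := by
      rw [← sum_Ico_eq_clock_sub hle, Finset.mul_sum]
      refine norm_sum_le_of_le _ fun r _ => ?_
      rw [norm_smul, Real.norm_of_nonneg (H.pos r).le, mul_comm]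
      exact mul_le_mul_of_nonneg_right (hK r) (H.pos r).le
    have h3 : clock a (clockIndex a t) - clock a (clockIndex a s) ≤
        |t - s| + η / (2 * (K + 1)) := by
      have e : η / (2 * (K + 1)) = η / (4 * (K + 1)) + η / (4 * (K + 1)) := by
        field_simp; ring
      have := abs_le.1 (hs₀ s hs).2
      have := abs_le.1 (hs₀ t (hs.trans hst)).2
      have := le_abs_self (t - s)
      linarith
    have h4 : 0 ≤ clock a (clockIndex a t) - clock a (clockIndex a s) :=
      sub_nonneg.2 ((clock_strictMono H.pos).monotone hle)
    have h5 : (K + 1) * (η / (2 * (K + 1))) = η / 2 := by field_simp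
    have h6 := norm_sub_norm_le (x (clockIndex a t) - x (clockIndex a s))
      (∑ r ∈ Finset.Ico (clockIndex a s) (clockIndex a t), a r • v r)
    have h7 := mul_le_mul_of_nonneg_left h3 (by linarith : 0 ≤ K + 1)
    rw [mul_add, h5] at h7
    nlinarith
  refine ⟨s₀, fun s t hs ht => ?_⟩
  rcases le_total s t with hst | hst
  · exact key s t hs hst
  · rw [norm_sub_rev, abs_sub_comm]
    exact key t s ht hst

/-- Along an ultrafilter at infinity the shifted iterates converge, at every time `t`, jointly in
the shift and in time near `t`. -/
theorem exists_limit [ProperSpace E] (H : IsPerturbedEuler a v x h) (U : Ultrafilter ℝ)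
    (hU : (U : Filter ℝ) ≤ atTop) :
    ∃ Z : ℝ → E, ∀ t, Tendsto (fun w : ℝ × ℝ => x (clockIndex a (w.2 + w.1)))
      (𝓝 t ×ˢ (U : Filter ℝ)) (𝓝 (Z t)) := by
  obtain ⟨R, hR⟩ := H.bounded
  have hpt : ∀ t : ℝ, ∃ z, Tendsto (fun s => x (clockIndex a (s + t))) U (𝓝 z) := by
    intro t
    obtain ⟨z, -, hz⟩ := (isCompact_closedBall (0 : E) R).ultrafilter_le_nhds
      (U.map fun s => x (clockIndex a (s + t)))
      (by
        rw [le_principal_iff, Ultrafilter.coe_map, mem_map]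
        exact Eventually.of_forall fun s => by simpa using hR (clockIndex a (s + t)))
    exact ⟨z, hz⟩
  choose Z hZ using hpt
  refine ⟨Z, fun t => Metric.tendsto_nhds.2 fun ε hε => ?_⟩
  obtain ⟨K, hK, hlip⟩ := H.exists_norm_interp_sub_le
  obtain ⟨s₀, hs₀⟩ := hlip (ε / 3) (by linarith)
  have hr : 0 < ε / (3 * K) := by positivity
  have e1 : ∀ᶠ t' in 𝓝 t, |t' - t| < ε / (3 * K) ∧ t - 1 < t' := by
    refine Eventually.and ?_ (lt_mem_nhds (by linarith))
    exact Metric.ball_mem_nhds t hr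
  have e2 : ∀ᶠ s in (U : Filter ℝ), s₀ - t + 1 ≤ s ∧
      dist (x (clockIndex a (s + t))) (Z t) < ε / 3 :=
    ((eventually_ge_atTop _).filter_mono hU).and (Metric.tendsto_nhds.1 (hZ t) _ (by linarith))
  filter_upwards [e1.prod_mk e2] with w ⟨⟨h1, h1'⟩, h2, h3⟩
  have h4 := hs₀ (w.2 + t) (w.2 + w.1) (by linarith) (by linarith)
  have h5 : K * |w.2 + w.1 - (w.2 + t)| < ε / 3 := by
    rw [add_sub_add_left_eq_sub]
    calc K * |w.1 - t| < K * (ε / (3 * K)) := mul_lt_mul_of_pos_left h1 hK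
      _ = ε / 3 := by field_simp
  have h6 := dist_triangle (x (clockIndex a (w.2 + w.1))) (x (clockIndex a (w.2 + t))) (Z t)
  rw [dist_eq_norm _ (x (clockIndex a (w.2 + t)))] at h6
  linarith

/-- Every limit of the shifted iterates along an ultrafilter at infinity is a solution, on the
whole line, of the averaged equation. -/
theorem hasDerivAt_limit (H : IsPerturbedEuler a v x h) {U : Ultrafilter ℝ}
    (hU : (U : Filter ℝ) ≤ atTop) {Z : ℝ → E}
    (hZ : ∀ t, Tendsto (fun w : ℝ × ℝ => x (clockIndex a (w.2 + w.1))) (𝓝 t ×ˢ (U : Filter ℝ))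
      (𝓝 (Z t))) (t₀ : ℝ) : HasDerivAt Z (h (Z t₀)) t₀ := by
  have hpt : ∀ t, Tendsto (fun s => x (clockIndex a (s + t))) U (𝓝 (Z t)) := fun t =>
    (hZ t).comp ((tendsto_const_nhds (x := t)).prodMk tendsto_id)
  have hshift : ∀ t, Tendsto (fun s : ℝ => s + t) U atTop := fun t =>
    (tendsto_atTop_add_const_right atTop t tendsto_id).mono_left hU
  rw [hasDerivAt_iff_isLittleO, Asymptotics.isLittleO_iff]
  intro ε hε
  obtain ⟨δ, hδ, havg⟩ := H.averaging (Z t₀) ε hε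
  obtain ⟨pt, hpt₀, pu, hpu, hnear⟩ := eventually_prod_iff.1
    (Metric.tendsto_nhds.1 (hZ t₀) δ hδ)
  obtain ⟨ρ, hρ, hball⟩ := Metric.eventually_nhds_iff_ball.1 hpt₀
  have key : ∀ t₁ t₂, t₁ ≤ t₂ → |t₁ - t₀| < ρ / 2 → |t₂ - t₀| < ρ / 2 →
      ‖Z t₂ - Z t₁ - (t₂ - t₁) • h (Z t₀)‖ ≤ ε * (t₂ - t₁) := by
    intro t₁ t₂ h12 ht₁ ht₂
    refine le_of_forall_pos_le_add fun η hη => ?_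
    obtain ⟨N₁, hN₁⟩ := havg (η / 2) (by linarith)
    obtain ⟨N₂, hN₂⟩ := H.residual (η / 2) (by linarith)
    have hgap : ∀ t, Tendsto (fun s => clock a (clockIndex a (s + t)) - (s + t)) U (𝓝 0) :=
      fun t => (tendsto_clock_clockIndex_sub H.pos H.not_summable H.tendsto_zero).comp (hshift t)
    have hτ : Tendsto (fun s => clock a (clockIndex a (s + t₂)) - clock a (clockIndex a (s + t₁)))
        U (𝓝 (t₂ - t₁)) := by
      have := ((hgap t₂).sub (hgap t₁)).add (tendsto_const_nhds (x := t₂ - t₁))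
      simp only [sub_zero, zero_add] at this
      refine this.congr fun s => by ring
    refine le_of_tendsto_of_tendsto
      (((hpt t₂).sub (hpt t₁)).sub (hτ.smul_const (h (Z t₀)))).norm
      ((hτ.const_mul ε).add_const η) ?_
    have hidx : ∀ᶠ s in (U : Filter ℝ), max N₁ N₂ ≤ clockIndex a (s + t₁) :=
      ((tendsto_clockIndex H.pos H.not_summable).comp
      (hshift t₁)).eventually_ge_atTop (max N₁ N₂)
    filter_upwards [hpu, hidx, (hshift t₂).eventually_ge_atTop 0,
      (hgap t₁).eventually (lt_mem_nhds (by linarith : -(ρ / 2) < 0))] with s hs hi hs0 hgs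
    have hle : clockIndex a (s + t₁) ≤ clockIndex a (s + t₂) :=
      clockIndex_mono H.pos H.not_summable (by linarith)
    have hmono := (clock_strictMono H.pos).monotone
    have h1 := hN₁ _ _ ((le_max_left _ _).trans hi) hle fun r hr => by
      rw [Finset.mem_Ico] at hr
      have hr1 := hmono hr.1
      have hr2 := (hmono hr.2.le).trans (clock_clockIndex_le (a := a) hs0)
      rw [abs_lt] at ht₁ ht₂
      have hmem : clock a r - s ∈ Metric.ball t₀ ρ := by
        rw [Metric.mem_ball, Real.dist_eq, abs_lt]
        constructor <;> linarith [ht₁.1, ht₂.2]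
      have := hnear (hball _ hmem) hs
      simpa [clockIndex_clock H.pos H.not_summable, dist_eq_norm] using this
    have h2 := hN₂ _ _ ((le_max_right _ _).trans hi) hle
    refine (norm_le_norm_sub_add _ (∑ r ∈ Finset.Ico (clockIndex a (s + t₁))
      (clockIndex a (s + t₂)), a r • v r - (clock a (clockIndex a (s + t₂)) -
        clock a (clockIndex a (s + t₁))) • h (Z t₀))).trans ?_
    rw [sub_sub_sub_cancel_right]
    linarith
  filter_upwards [Metric.ball_mem_nhds t₀ (half_pos hρ)] with t ht
  rw [Metric.mem_ball, Real.dist_eq] at ht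
  have h0 : |t₀ - t₀| < ρ / 2 := by simpa using hρ
  rcases le_total t₀ t with hle | hle
  · rw [Real.norm_of_nonneg (sub_nonneg.2 hle)]
    exact key t₀ t hle h0 ht
  · rw [Real.norm_of_nonpos (sub_nonpos.2 hle), neg_sub, ← norm_neg]
    have e : -(Z t - Z t₀ - (t - t₀) • h (Z t₀)) = Z t₀ - Z t - (t₀ - t) • h (Z t₀) := by module
    rw [e]
    exact key t t₀ hle ht h0

/-! ### Convergence to a locally asymptotically stable point -/

/-- If `p` holds at arbitrarily late times, the iterates shifted by times at which `p` holds have a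
limit along an ultrafilter, and the limit solves the averaged equation. -/
theorem exists_solution_of_frequently [ProperSpace E] (H : IsPerturbedEuler a v x h) {p : ℝ → Prop}
    (hp : ∃ᶠ s in atTop, p s) :
    ∃ (U : Ultrafilter ℝ) (Z : ℝ → E), (U : Filter ℝ) ≤ atTop ∧ (∀ᶠ s in (U : Filter ℝ), p s) ∧
      (∀ t, Tendsto (fun w : ℝ × ℝ => x (clockIndex a (w.2 + w.1))) (𝓝 t ×ˢ (U : Filter ℝ))
        (𝓝 (Z t))) ∧ (∀ t, Tendsto (fun s => x (clockIndex a (s + t))) U (𝓝 (Z t))) ∧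
      ∀ s, IsIntegralCurveOn Z (fun _ => h) s := by
  have hne : NeBot (atTop ⊓ 𝓟 {s | p s}) := frequently_iff_neBot.1 hp
  obtain ⟨U, hU⟩ := Ultrafilter.exists_le (atTop ⊓ 𝓟 {s | p s})
  have hU1 : (U : Filter ℝ) ≤ atTop := hU.trans inf_le_left
  obtain ⟨Z, hZ⟩ := H.exists_limit U hU1
  refine ⟨U, Z, hU1, ?_, hZ, fun t => (hZ t).comp ((tendsto_const_nhds (x := t)).prodMk tendsto_id),
    fun s t _ => (H.hasDerivAt_limit hU1 hZ t).hasDerivWithinAt⟩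
  exact le_principal_iff.1 (hU.trans inf_le_right)

/-- A bounded perturbed Euler scheme that visits a compact part of the domain of attraction
infinitely often converges. The attraction of the limiting solutions brings the iterates close
to `y`; stability, again for the limiting solutions, keeps them there. -/
theorem tendsto_of_locallyAsymptoticallyStable [ProperSpace E] (H : IsPerturbedEuler a v x h)
    {y : E} (hy : LocallyAsymptoticallyStable h y) {A : Set E} (hA : IsCompact A)
    (hAsub : A ⊆ domainOfAttraction h y) (hfreq : ∃ᶠ k in atTop, x k ∈ A) :
    Tendsto x atTop (𝓝 y) := by
  obtain ⟨⟨-, hstab⟩, hdom⟩ := hy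
  have hX : ∀ ε > 0, ∀ᶠ s in atTop, ‖x (clockIndex a s) - y‖ < ε := by
    intro ε hε
    obtain ⟨δ₀, hδ₀, hstay⟩ := hstab ε hε
    obtain ⟨r, hr, hrsub⟩ := Metric.nhds_basis_closedBall.mem_iff.1 hdom
    obtain ⟨δ, hδ, hδlt, hδr⟩ : ∃ δ > 0, δ < δ₀ ∧ δ ≤ r :=
      ⟨min (δ₀ / 2) r, by positivity, (min_le_left _ _).trans_lt (by linarith), min_le_right _ _⟩
    -- From late times in the `δ`-ball the iterates return to it, after time at least one,
    -- without leaving the `ε`-ball.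
    have hreturn : ∀ᶠ s in atTop, ‖x (clockIndex a s) - y‖ ≤ δ → ∃ T ≥ (1 : ℝ),
        (∀ t ∈ Set.Icc 0 T, ‖x (clockIndex a (s + t)) - y‖ < ε) ∧
          ‖x (clockIndex a (s + T)) - y‖ ≤ δ := by
      by_contra hcon
      obtain ⟨U, Z, hU, hpU, hZ, hZp, hode⟩ :=
        H.exists_solution_of_frequently (not_eventually.1 hcon)
      simp only [Classical.not_imp] at hpU
      have hZ0 : ‖Z 0 - y‖ ≤ δ := by
        refine le_of_tendsto ((hZp 0).sub_const y).norm ?_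
        filter_upwards [hpU] with s hs
        simpa using hs.1
      have hlim : Tendsto Z atTop (𝓝 y) :=
        (hrsub (by simpa [dist_eq_norm] using hZ0.trans hδr)).2 Z rfl (hode _)
      obtain ⟨T, hT1, hT⟩ := ((eventually_ge_atTop (1 : ℝ)).and
        (hlim.eventually (Metric.ball_mem_nhds y hδ))).exists
      have hZstay := hstay T Z (hode _) (hZ0.trans_lt hδlt)
      have hunif : ∀ᶠ s in (U : Filter ℝ), ∀ t ∈ Set.Icc 0 T,
          ‖x (clockIndex a (s + t)) - y‖ < ε := by
        have hloc : ∀ t ∈ Set.Icc 0 T, ∃ u ∈ 𝓝[Set.Icc 0 T] t, ∀ᶠ s in (U : Filter ℝ), ∀ t' ∈ u,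
            ‖x (clockIndex a (s + t')) - y‖ < ε := by
          intro t ht
          obtain ⟨pt, hpt, pu, hpu, hw⟩ := eventually_prod_iff.1
            ((((hZ t).sub_const y).norm).eventually (gt_mem_nhds (hZstay t ht)))
          exact ⟨{t | pt t}, mem_nhdsWithin_of_mem_nhds hpt,
            hpu.mono fun s hs t' ht' => hw ht' hs⟩
        refine isCompact_Icc.induction_on (p := fun u => ∀ᶠ s in (U : Filter ℝ), ∀ t' ∈ u,
            ‖x (clockIndex a (s + t')) - y‖ < ε) (by simp) (fun u w huw hw => ?_)
          (fun u w hu hw => ?_) hloc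
        · exact hw.mono fun s hs t' ht' => hs t' (huw ht')
        · filter_upwards [hu, hw] with s h1 h2 t' ht'
          exact ht'.elim (h1 t') (h2 t')
      have hend : ∀ᶠ s in (U : Filter ℝ), ‖x (clockIndex a (s + T)) - y‖ < δ := by
        refine ((hZp T).sub_const y).norm.eventually (gt_mem_nhds ?_)
        simpa [dist_eq_norm] using hT
      obtain ⟨s, h1, h2, h3⟩ := (hpU.and (hunif.and hend)).exists
      exact h1.2 ⟨T, hT1, h2, h3.le⟩
    -- The visits to `A` bring the iterates into the `δ`-ball at arbitrarily late times.
    have henter : ∃ᶠ s in atTop, ‖x (clockIndex a s) - y‖ ≤ δ := by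
      have hfreq' : ∃ᶠ s in atTop, x (clockIndex a s) ∈ A := by
        refine (clock_tendsto H.pos H.not_summable).frequently (hfreq.mono fun k hk => ?_)
        rwa [clockIndex_clock H.pos H.not_summable]
      obtain ⟨U, Z, hU, hpU, hZ, hZp, hode⟩ := H.exists_solution_of_frequently hfreq'
      have hZ0 : Z 0 ∈ A := hA.isClosed.mem_of_tendsto (hZp 0) (by simpa using hpU)
      have hlim : Tendsto Z atTop (𝓝 y) := (hAsub hZ0).2 Z rfl (hode _)
      obtain ⟨T, hT⟩ := (hlim.eventually (Metric.ball_mem_nhds y hδ)).exists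
      have hend : ∀ᶠ s in (U : Filter ℝ), ‖x (clockIndex a (s + T)) - y‖ < δ := by
        refine ((hZp T).sub_const y).norm.eventually (gt_mem_nhds ?_)
        simpa [dist_eq_norm] using hT
      have hsh : Tendsto (fun s : ℝ => s + T) U atTop :=
        (tendsto_atTop_add_const_right atTop T tendsto_id).mono_left hU
      exact hsh.frequently (hend.mono fun s hs => hs.le).frequently
    obtain ⟨s₁, hs₁⟩ := eventually_atTop.1 hreturn
    obtain ⟨s₂, hs₂, hin⟩ := (frequently_atTop.1 henter) s₁
    have hiter : ∀ n : ℕ, ∃ s ≥ s₂ + n, ‖x (clockIndex a s) - y‖ ≤ δ ∧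
        ∀ u, s₂ ≤ u → u < s → ‖x (clockIndex a u) - y‖ < ε := by
      intro n
      induction n with
      | zero => exact ⟨s₂, by simp, hin, fun u h1 h2 => absurd h2 (not_lt.2 h1)⟩
      | succ n ih =>
        obtain ⟨s, hs, hsδ, hsε⟩ := ih
        have hn : (0 : ℝ) ≤ n := n.cast_nonneg
        obtain ⟨T, hT, hTε, hTδ⟩ := hs₁ s (by linarith) hsδ
        refine ⟨s + T, by push_cast; linarith, hTδ, fun u h1 h2 => ?_⟩
        rcases lt_or_ge u s with hus | hus
        · exact hsε u h1 hus
        · simpa using hTε (u - s) ⟨by linarith, by linarith⟩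
    filter_upwards [eventually_ge_atTop s₂] with u hu
    obtain ⟨n, hn⟩ := exists_nat_gt (u - s₂)
    obtain ⟨s, hs, -, hsε⟩ := hiter n
    exact hsε u hu (by linarith)
  refine Metric.tendsto_nhds.2 fun ε hε => ?_
  filter_upwards [(clock_tendsto H.pos H.not_summable).eventually (hX ε hε)] with k hk
  rwa [clockIndex_clock H.pos H.not_summable, ← dist_eq_norm] at hk

end IsPerturbedEuler

/-! ### Gains along the queue -/

namespace GainCondition

variable {q : ℝ} {a b : ℕ → ℝ} {ρ : ℝ → ℝ}

theorem tendsto_rho_left (h : GainCondition q a b ρ) (hq0 : 0 < q) (hq1 : q ≤ 1) :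
    Tendsto (fun ε => ρ (q - ε)) (𝓝[>] 0) (𝓝 (ρ q)) := by
  refine h.continuousWithinAt.tendsto.comp (tendsto_nhdsWithin_iff.2 ⟨?_, ?_⟩)
  · have : Tendsto (fun ε : ℝ => q - ε) (𝓝 0) (𝓝 (q - 0)) :=
        (continuous_const.sub continuous_id).tendsto 0
    rw [sub_zero] at this
    exact this.mono_left nhdsWithin_le_nhds
  · filter_upwards [self_mem_nhdsWithin, nhdsWithin_le_nhds (gt_mem_nhds hq0)] with ε h1 h2
    exact ⟨by linarith, by linarith [Set.mem_Ioi.1 h1]⟩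

theorem tendsto_rho_right (h : GainCondition q a b ρ) (hq0 : 0 < q) (hq1 : q < 1) :
    Tendsto (fun ε => ρ (q + ε)) (𝓝[>] 0) (𝓝 (ρ q)) := by
  refine h.continuousWithinAt.tendsto.comp (tendsto_nhdsWithin_iff.2 ⟨?_, ?_⟩)
  · have : Tendsto (fun ε : ℝ => q + ε) (𝓝 0) (𝓝 (q + 0)) :=
        (continuous_const.add continuous_id).tendsto 0
    rw [add_zero] at this
    exact this.mono_left nhdsWithin_le_nhds
  · filter_upwards [self_mem_nhdsWithin, nhdsWithin_le_nhds (gt_mem_nhds (sub_pos.2 hq1))]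
      with ε h1 h2
    exact ⟨by linarith [Set.mem_Ioi.1 h1], by linarith⟩

/-- The gains of the queue are asymptotically at most `ρ q` times the reference gains. -/
theorem eventually_lt (h : GainCondition q a b ρ) (ha : ∀ k, 0 < a k) (hq0 : 0 < q) (hq1 : q ≤ 1)
    {N : ℕ → ℕ} (hN : Tendsto (fun k => (N k : ℝ) / k) atTop (𝓝 q)) {u : ℝ} (hu : ρ q < u) :
    ∀ᶠ k in atTop, b (N k) / a k < u := by
  obtain ⟨ε, ⟨⟨h1, h2⟩, h3⟩, hε⟩ := (((h.tendsto_left.and ((h.tendsto_rho_left hq0 hq1).eventually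
    (gt_mem_nhds hu))).and (nhdsWithin_le_nhds (gt_mem_nhds hq0))).and
      self_mem_nhdsWithin).exists
  filter_upwards [(h1 (by linarith)).eventually (gt_mem_nhds h2),
    hN.eventually (lt_mem_nhds (by linarith : q - ε < q)), eventually_gt_atTop 0] with k h4 h5 hk
  refine lt_of_le_of_lt ?_ h4
  have hk' : (0 : ℝ) < k := by exact_mod_cast hk
  rw [lt_div_iff₀ hk'] at h5
  refine div_le_div_of_nonneg_right (h.strictAnti.antitone ?_) (ha k).le
  exact Nat.floor_le_of_le (by linarith)

/-- At selection probability `1` the gain conditions only concern `b ⌊k (1 - ε)⌋`. They still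
bound `b k / a k` from below: `k = ⌊m (1 - ε)⌋` for some `m` close to `k / (1 - ε)`, and the
decrease of `a` between `k` and `m` is controlled by the conditions for `ε` and `3 ε`. -/
theorem eventually_gt_of_one (h : GainCondition 1 a b ρ) (ha : ∀ k, 0 < a k) {l : ℝ}
    (hl : l < ρ 1) : ∀ᶠ k in atTop, l < b k / a k := by
  have hρ := h.limit_pos
  have hlim := h.tendsto_rho_left one_pos le_rfl
  have hscale : Tendsto (fun ε : ℝ => 3 * ε) (𝓝[>] 0) (𝓝[>] 0) := by
    refine tendsto_nhdsWithin_iff.2 ⟨?_, ?_⟩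
    · have : Tendsto (fun ε : ℝ => 3 * ε) (𝓝 0) (𝓝 (3 * 0)) :=
        (continuous_const.mul continuous_id).tendsto 0
      rw [mul_zero] at this
      exact this.mono_left nhdsWithin_le_nhds
    · filter_upwards [self_mem_nhdsWithin] with ε hε
      simpa using hε
  have hlim3 := hlim.comp hscale
  have hprod : Tendsto (fun ε => ρ (1 - ε) * ρ (1 - ε) / ρ (1 - 3 * ε)) (𝓝[>] 0) (𝓝 (ρ 1)) := by
    have := (hlim.mul hlim).div hlim3 hρ.ne'
    rwa [mul_div_assoc, div_self hρ.ne', mul_one] at this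
  obtain ⟨ε, ⟨⟨⟨⟨h1, h2⟩, h3⟩, hρ3⟩, hε3⟩, hε⟩ := (((((h.tendsto_left.and
    (hscale.eventually h.tendsto_left)).and (hprod.eventually (lt_mem_nhds hl))).and
    (hlim3.eventually (lt_mem_nhds hρ))).and (nhdsWithin_le_nhds (gt_mem_nhds
      (by norm_num : (0 : ℝ) < 1 / 3)))).and self_mem_nhdsWithin).exists
  simp only [Function.comp_apply] at hρ3
  have h1 := h1 (by linarith)
  have h2 := h2 (by linarith)
  have hc : 0 < 1 - ε := by linarith
  set m : ℕ → ℕ := fun k => ⌈(k : ℝ) / (1 - ε)⌉₊ with hm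
  have hmk : ∀ k, k ≤ ⌊(m k : ℝ) * (1 - ε)⌋₊ := fun k =>
    Nat.le_floor ((div_le_iff₀ hc).1 (Nat.le_ceil _))
  have hkm : ∀ k, k ≤ m k := fun k => by
    refine Nat.cast_le.1 (le_trans ?_ (Nat.le_ceil ((k : ℝ) / (1 - ε))))
    rw [le_div_iff₀ hc]
    nlinarith [(k.cast_nonneg : (0 : ℝ) ≤ k)]
  have hmtop : Tendsto m atTop atTop := tendsto_atTop_mono hkm tendsto_id
  have hlimk := ((h1.comp hmtop).mul h1).div (h2.comp hmtop) hρ3.ne'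
  filter_upwards [hlimk.eventually (lt_mem_nhds h3), tendsto_natCast_atTop_atTop.eventually
    (eventually_ge_atTop (1 / ε))] with k hk hkbig
  refine hk.trans_le ?_
  have hle : ⌊(m k : ℝ) * (1 - 3 * ε)⌋₊ ≤ ⌊(k : ℝ) * (1 - ε)⌋₊ := by
    refine Nat.floor_mono ?_
    have hm1 : (m k : ℝ) * (1 - ε) ≤ k + (1 - ε) := by
      have := (Nat.ceil_lt_add_one (div_nonneg k.cast_nonneg hc.le : 0 ≤ (k : ℝ) / (1 - ε))).le
      have := mul_le_mul_of_nonneg_right this hc.le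
      rwa [add_mul, div_mul_cancel₀ _ hc.ne', one_mul] at this
    have hm2 : 1 ≤ (k : ℝ) * ε := (div_le_iff₀ hε).1 hkbig
    have hm3 : 0 ≤ 1 - 3 * ε := by linarith
    -- `m (1 - ε) ≤ k (1 + ε)` and `(1 + ε) (1 - 3 ε) ≤ (1 - ε)²`
    have hm4 : (m k : ℝ) * (1 - ε) ≤ k * (1 + ε) := by nlinarith
    have hm5 := mul_le_mul_of_nonneg_right hm4 hm3
    have hm6 : (k : ℝ) * (1 + ε) * (1 - 3 * ε) ≤ (k * (1 - ε)) * (1 - ε) := by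
      have : 0 ≤ (k : ℝ) * ε ^ 2 := by positivity
      nlinarith
    refine le_of_mul_le_mul_right ?_ hc
    linarith
  have hb1 : b ⌊(m k : ℝ) * (1 - ε)⌋₊ ≤ b k := h.strictAnti.antitone (hmk k)
  have hb2 : b ⌊(k : ℝ) * (1 - ε)⌋₊ ≤ b ⌊(m k : ℝ) * (1 - 3 * ε)⌋₊ := h.strictAnti.antitone hle
  have p1 := h.pos ⌊(m k : ℝ) * (1 - 3 * ε)⌋₊
  have p2 := h.pos ⌊(k : ℝ) * (1 - ε)⌋₊
  have p3 := h.pos k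
  have pm := ha (m k)
  have pk := ha k
  simp only [Function.comp_apply]
  calc b ⌊(m k : ℝ) * (1 - ε)⌋₊ / a (m k) * (b ⌊(k : ℝ) * (1 - ε)⌋₊ / a k) /
        (b ⌊(m k : ℝ) * (1 - 3 * ε)⌋₊ / a (m k))
      = b ⌊(m k : ℝ) * (1 - ε)⌋₊ *
          (b ⌊(k : ℝ) * (1 - ε)⌋₊ / b ⌊(m k : ℝ) * (1 - 3 * ε)⌋₊) / a k := by
        field_simp
    _ ≤ b k * 1 / a k := by
        have : b ⌊(k : ℝ) * (1 - ε)⌋₊ / b ⌊(m k : ℝ) * (1 - 3 * ε)⌋₊ ≤ 1 :=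
          (div_le_one p1).2 hb2
        gcongr
    _ = b k / a k := by rw [mul_one]

theorem eventually_gt (h : GainCondition q a b ρ) (ha : ∀ k, 0 < a k) (hq0 : 0 < q) (hq1 : q ≤ 1)
    {N : ℕ → ℕ} (hN : Tendsto (fun k => (N k : ℝ) / k) atTop (𝓝 q)) (hNk : ∀ k, N k ≤ k)
    {l : ℝ} (hl : l < ρ q) : ∀ᶠ k in atTop, l < b (N k) / a k := by
  rcases hq1.lt_or_eq with hq1 | rfl
  · obtain ⟨ε, ⟨⟨h1, h2⟩, h3⟩, hε⟩ := (((h.tendsto_right.and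
      ((h.tendsto_rho_right hq0 hq1).eventually (lt_mem_nhds hl))).and
        (nhdsWithin_le_nhds (gt_mem_nhds (sub_pos.2 hq1)))).and self_mem_nhdsWithin).exists
    filter_upwards [(h1 (by linarith)).eventually (lt_mem_nhds h2),
      hN.eventually (gt_mem_nhds (by linarith : q < q + ε)), eventually_gt_atTop 0] with k h4 h5 hk
    refine h4.trans_le ?_
    have hk' : (0 : ℝ) < k := by exact_mod_cast hk
    rw [div_lt_iff₀ hk'] at h5
    refine div_le_div_of_nonneg_right (h.strictAnti.antitone ?_) (ha k).le
    have := (le_of_lt h5).trans ((mul_comm _ _).le.trans (Nat.le_ceil ((k : ℝ) * (q + ε))))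
    exact_mod_cast this
  · filter_upwards [h.eventually_gt_of_one ha hl] with k hk
    exact hk.trans_le (div_le_div_of_nonneg_right (h.strictAnti.antitone (hNk k)) (ha k).le)

/-- If the fraction of used elements tends to `q`, the ratio of the queued gain to the reference
gain tends to `ρ q`. -/
theorem tendsto_queue_ratio (h : GainCondition q a b ρ) (ha : ∀ k, 0 < a k) (hq0 : 0 < q)
    (hq1 : q ≤ 1) {N : ℕ → ℕ} (hN : Tendsto (fun k => (N k : ℝ) / k) atTop (𝓝 q))
    (hNk : ∀ k, N k ≤ k) : Tendsto (fun k => b (N k) / a k) atTop (𝓝 (ρ q)) :=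
  tendsto_order.2 ⟨fun _ hl => h.eventually_gt ha hq0 hq1 hN hNk hl,
    fun _ hu => h.eventually_lt ha hq0 hq1 hN hu⟩

end GainCondition

/-! ### Almost sure behaviour of the selection and of the noise -/

section Probability

variable {Ω : Type*} [MeasurableSpace Ω] {P : Measure Ω}

/-- **Kolmogorov's convergence criterion** for independent, bounded, centred summands: the partial
sums form an `L²`-bounded martingale. -/
theorem ae_exists_tendsto_sum_of_iIndepFun [IsProbabilityMeasure P] {Y : ℕ → Ω → ℝ} {c : ℕ → ℝ}
    (hmeas : ∀ k, Measurable (Y k)) (hindep : iIndepFun Y P) (hbdd : ∀ k ω, |Y k ω| ≤ c k)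
    (hmean : ∀ k, ∫ ω, Y k ω ∂P = 0) (hsum : Summable fun k => c k ^ 2) :
    ∀ᵐ ω ∂P, ∃ l, Tendsto (fun n => ∑ r ∈ Finset.range n, Y r ω) atTop (𝓝 l) := by
  have hLp : ∀ k, MemLp (Y k) 2 P := fun k =>
    MemLp.of_bound (hmeas k).aestronglyMeasurable (c k) (Eventually.of_forall (hbdd k))
  have hint : ∀ k, Integrable (Y k) P := fun k => (hLp k).integrable one_le_two
  set M : ℕ → Ω → ℝ := fun n => ∑ r ∈ Finset.range (n + 1), Y r with hM
  have hMint : ∀ n, Integrable (M n) P := fun n => integrable_finsetSum' _ fun r _ => hint r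
  have hMLp : ∀ n, MemLp (M n) 2 P := fun n => memLp_finsetSum' _ fun r _ => hLp r
  let ℱ := Filtration.natural Y fun k => (hmeas k).stronglyMeasurable
  have hmart : Martingale M ℱ P := by
    refine martingale_of_condExp_sub_eq_zero_nat (fun n => ?_) hMint fun n => ?_
    · refine Finset.stronglyMeasurable_sum _ fun r hr => ?_
      exact (Filtration.stronglyAdapted_natural (fun k => (hmeas k).stronglyMeasurable) r).mono
        (ℱ.mono (Nat.lt_succ_iff.1 (Finset.mem_range.1 hr)))
    · have e : M (n + 1) - M n = Y (n + 1) := by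
        simp [hM, Finset.sum_range_succ _ (n + 1)]
      rw [e]
      filter_upwards [iIndepFun.condExp_natural_ae_eq_of_lt
        (fun k => (hmeas k).stronglyMeasurable) hindep (Nat.lt_succ_self n)] with ω hω
      rw [hω, hmean]; rfl
  have hvar : ∀ n, ∫ ω, M n ω ^ 2 ∂P ≤ ∑' k, c k ^ 2 := by
    intro n
    have hMmean : ∫ ω, M n ω ∂P = 0 := by
      simp only [hM, Finset.sum_apply]
      rw [integral_finsetSum _ fun r _ => hint r]
      simp [hmean]
    have h1 : variance (M n) P = ∫ ω, M n ω ^ 2 ∂P := by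
      rw [variance_of_integral_eq_zero (hMLp n).aemeasurable hMmean]
    rw [← h1, hM, IndepFun.variance_sum (fun r _ => hLp r)
      fun i _ j _ hij => hindep.indepFun hij]
    refine le_trans (Finset.sum_le_sum fun r _ => ?_) (hsum.sum_le_tsum _ fun r _ => sq_nonneg _)
    rw [variance_of_integral_eq_zero (hmeas r).aemeasurable (hmean r)]
    calc ∫ ω, Y r ω ^ 2 ∂P ≤ ∫ _, c r ^ 2 ∂P :=
          integral_mono (hLp r).integrable_sq (integrable_const _) fun ω =>
            sq_le_sq' (abs_le.1 (hbdd r ω)).1 (abs_le.1 (hbdd r ω)).2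
      _ = c r ^ 2 := by simp
  have hL1 : ∀ n, eLpNorm (M n) 1 P ≤ (Real.toNNReal (1 + ∑' k, c k ^ 2) : ENNReal) := by
    intro n
    rw [eLpNorm_one_eq_lintegral_enorm, ← ofReal_integral_norm_eq_lintegral_enorm (hMint n)]
    refine ENNReal.ofReal_le_ofReal ?_
    calc ∫ ω, ‖M n ω‖ ∂P ≤ ∫ ω, (1 + M n ω ^ 2) ∂P := by
          refine integral_mono (hMint n).norm ((integrable_const 1).add (hMLp n).integrable_sq)
            fun ω => ?_
          rw [Real.norm_eq_abs]
          nlinarith [sq_nonneg (|M n ω| - 1), sq_abs (M n ω)]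
      _ = 1 + ∫ ω, M n ω ^ 2 ∂P := by
          rw [integral_add (integrable_const 1) (hMLp n).integrable_sq]; simp
      _ ≤ _ := by linarith [hvar n]
  filter_upwards [hmart.submartingale.exists_ae_tendsto_of_bdd hL1] with ω ⟨l, hl⟩
  refine ⟨l, (tendsto_add_atTop_iff_nat 1).1 (hl.congr fun n => ?_)⟩
  simp [hM]

/-- The maximal-tail condition on a random series gives almost sure smallness of late blocks. -/
theorem ae_block_sum_small {E : Type*} [NormedAddCommGroup E] {f : ℕ → Ω → E}
    (h : ∀ ε : ℝ, 0 < ε → Tendsto (fun k => P {ω | ENNReal.ofReal ε ≤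
      ⨆ m : ℕ, ⨆ _ : k ≤ m, ‖∑ r ∈ Finset.Icc k m, f r ω‖ₑ}) atTop (𝓝 0)) :
    ∀ᵐ ω ∂P, ∀ η > 0, ∃ N, ∀ n m, N ≤ n → n ≤ m → ‖∑ r ∈ Finset.Ico n m, f r ω‖ ≤ η := by
  have key : ∀ j : ℕ, ∀ᵐ ω ∂P, ∃ k, ∀ m, k ≤ m →
      ‖∑ r ∈ Finset.Ico k m, f r ω‖ < 1 / ((j : ℝ) + 1) := by
    intro j
    have hj : (0 : ℝ) < 1 / ((j : ℝ) + 1) := by positivity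
    refine le_antisymm (ge_of_tendsto' (h _ hj) fun k => measure_mono fun ω hω => ?_) bot_le
    simp only [Set.mem_compl_iff, Set.mem_ofPred_eq, not_exists, not_forall, not_lt] at hω
    obtain ⟨m, hkm, hm⟩ := hω k
    rcases Nat.eq_zero_or_pos m with rfl | hm0
    · simp at hm
      exact absurd hm (not_le.2 (by positivity))
    obtain ⟨m, rfl⟩ : ∃ l, m = l + 1 := ⟨m - 1, by omega⟩
    have hkm' : k ≤ m := by
      by_contra hlt
      rw [Finset.Ico_eq_empty (by omega), Finset.sum_empty, norm_zero] at hm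
      linarith
    change ENNReal.ofReal _ ≤ _
    refine le_trans ?_ (le_iSup₂ (f := fun m (_ : k ≤ m) => ‖∑ r ∈ Finset.Icc k m, f r ω‖ₑ) m hkm')
    rw [← ofReal_norm]
    refine ENNReal.ofReal_le_ofReal ?_
    have e : Finset.Icc k m = Finset.Ico k (m + 1) := by
      ext r
      simp only [Finset.mem_Icc, Finset.mem_Ico]
      omega
    rwa [e]
  filter_upwards [ae_all_iff.2 key] with ω hω η hη
  obtain ⟨j, hj⟩ := exists_nat_one_div_lt (half_pos hη)
  obtain ⟨k, hk⟩ := hω j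
  refine ⟨k, fun n m hn hm => ?_⟩
  have e : ∑ r ∈ Finset.Ico n m, f r ω =
      ∑ r ∈ Finset.Ico k m, f r ω - ∑ r ∈ Finset.Ico k n, f r ω := by
    rw [← Finset.sum_Ico_consecutive _ hn hm, add_sub_cancel_left]
  rw [e]
  have h1 := norm_sub_le (∑ r ∈ Finset.Ico k m, f r ω) (∑ r ∈ Finset.Ico k n, f r ω)
  linarith [hk m (hn.trans hm), hk n hn]

variable {d : ℕ} {sel : ℕ → Ω → Fin d} {q : Fin d → ℝ}

theorem integral_selection_indicator (hmeas : ∀ k, Measurable (sel k))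
    (hlaw : ∀ k j, P.real {ω | sel k ω = j} = q j) (j : Fin d) (k : ℕ) :
    ∫ ω, (if sel k ω = j then (1 : ℝ) else 0) ∂P = q j := by
  have hms : MeasurableSet {ω | sel k ω = j} := hmeas k (measurableSet_singleton j)
  rw [← hlaw k j, ← integral_indicator_one hms]
  simp [Set.indicator]

/-- By the strong law of large numbers each subvector is used with its selection frequency. -/
theorem ae_tendsto_usageCount_div [IsProbabilityMeasure P] (hmeas : ∀ k, Measurable (sel k))
    (hlaw : ∀ k j, P.real {ω | sel k ω = j} = q j) (hindep : iIndepFun sel P) (j : Fin d) :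
    ∀ᵐ ω ∂P, Tendsto (fun k : ℕ => (usageCount sel j k ω : ℝ) / k) atTop (𝓝 (q j)) := by
  let φ : Fin d → ℝ := fun i => if i = j then 1 else 0
  have hφ : Measurable φ := measurable_of_finite φ
  have hid : ∀ k, IdentDistrib (sel k) (sel 0) P P := fun k => by
    refine ⟨(hmeas k).aemeasurable, (hmeas 0).aemeasurable, ?_⟩
    refine Measure.ext_of_singleton fun i => ?_
    rw [Measure.map_apply (hmeas k) (measurableSet_singleton i),
      Measure.map_apply (hmeas 0) (measurableSet_singleton i)]
    have := (hlaw k i).trans (hlaw 0 i).symm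
    exact (measureReal_eq_measureReal_iff (by finiteness) (by finiteness)).1 this
  have hint : Integrable (fun ω => φ (sel 0 ω)) P :=
    Integrable.of_bound (hφ.comp (hmeas 0)).aestronglyMeasurable 1
      (Eventually.of_forall fun ω => by dsimp only [φ]; split_ifs <;> simp)
  have := strong_law_ae_real (fun k ω => φ (sel k ω)) hint
    (fun i k hik => (hindep.indepFun hik).comp hφ hφ) (fun k => (hid k).comp hφ)
  filter_upwards [this] with ω hω
  have e : ∫ ω, φ (sel 0 ω) ∂P = q j := integral_selection_indicator hmeas hlaw j 0
  rw [e] at hω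
  refine hω.congr fun k => ?_
  simp [φ, usageCount]

/-- The weighted deviations of the selections from their probabilities form a convergent series. -/
theorem ae_block_sum_selection_small [IsProbabilityMeasure P] (hmeas : ∀ k, Measurable (sel k))
    (hlaw : ∀ k j, P.real {ω | sel k ω = j} = q j) (hindep : iIndepFun sel P) {a : ℕ → ℝ}
    (ha : ∀ k, 0 < a k) (hsq : Summable fun k => a k ^ 2) (j : Fin d) :
    ∀ᵐ ω ∂P, ∀ η > 0, ∃ N, ∀ n m, N ≤ n → n ≤ m →
      |∑ r ∈ Finset.Ico n m, a r * ((if sel r ω = j then 1 else 0) - q j)| ≤ η := by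
  let φ : ℕ → Fin d → ℝ := fun r i => a r * ((if i = j then 1 else 0) - q j)
  have hφ : ∀ r, Measurable (φ r) := fun r => measurable_of_finite _
  have hq : 0 ≤ q j ∧ q j ≤ 1 := by
    rw [← hlaw 0 j]; exact ⟨measureReal_nonneg, measureReal_le_one⟩
  have := ae_exists_tendsto_sum_of_iIndepFun (P := P) (Y := fun r ω => φ r (sel r ω)) (c := a)
    (fun r => (hφ r).comp (hmeas r)) (hindep.comp φ hφ)
    (fun r ω => by
      simp only [φ]
      rw [abs_mul, abs_of_pos (ha r)]
      refine mul_le_of_le_one_right (ha r).le ?_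
      rw [abs_le]
      split_ifs <;> constructor <;> linarith [hq.1, hq.2])
    (fun r => by
      simp only [φ]
      rw [integral_const_mul, integral_sub, integral_selection_indicator hmeas hlaw]
      · simp
      · exact Integrable.of_bound ((measurable_of_finite
          (fun i : Fin d => if i = j then (1 : ℝ) else 0)).comp (hmeas r)).aestronglyMeasurable 1
          (Eventually.of_forall fun ω => by split_ifs <;> simp)
      · exact integrable_const _) hsq
  filter_upwards [this] with ω ⟨l, hl⟩ η hη
  obtain ⟨N, hN⟩ := Metric.cauchySeq_iff.1 hl.cauchySeq η hη
  refine ⟨N, fun n m hn hm => ?_⟩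
  rw [Finset.sum_Ico_eq_sub _ hm, ← Real.dist_eq]
  exact (hN m (hn.trans hm) n hn).le

end Probability

/-! ### Randomly selected updates as a perturbed Euler scheme -/

section Selection

variable {E : Type*} [NormedAddCommGroup E] [NormedSpace ℝ E] {ι : Type*} [Fintype ι]

theorem exists_bound_closedBall {E : Type*} [NormedAddCommGroup E] [ProperSpace E]
    {F : ι → E → E} (hF : ∀ j, Continuous (F j))
    (R : ℝ) : ∃ K, 0 ≤ K ∧ ∀ j z, ‖z‖ ≤ R → ‖F j z‖ ≤ K := by
  have h := fun j => (isCompact_closedBall (0 : E) R).exists_bound_of_continuousOn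
    (hF j).continuousOn
  choose C hC using h
  refine ⟨∑ j, |C j|, Finset.sum_nonneg fun j _ => abs_nonneg _, fun j z hz => ?_⟩
  refine ((hC j z (by simpa using hz)).trans (le_abs_self _)).trans ?_
  exact Finset.single_le_sum (f := fun j => |C j|) (fun i _ => abs_nonneg _) (Finset.mem_univ j)

/-- Replacing the selected field by its mean over a block of iterations, at a fixed point, costs
only the weighted deviations of the selections from their probabilities. -/
theorem sum_selected_sub_eq [DecidableEq ι] {a : ℕ → ℝ} {sel : ℕ → ι} {q : ι → ℝ} (f : ι → E)
    (s : Finset ℕ) :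
    ∑ r ∈ s, a r • f (sel r) - (∑ r ∈ s, a r) • ∑ j, q j • f j =
      ∑ j, (∑ r ∈ s, a r * ((if sel r = j then 1 else 0) - q j)) • f j := by
  have h : ∀ r, a r • f (sel r) = ∑ j, (a r * (if sel r = j then 1 else 0)) • f j := fun r => by
    simp [ite_smul]
  simp only [h, mul_sub, Finset.sum_sub_distrib, sub_smul, ← Finset.sum_mul, mul_smul,
    Finset.smul_sum, Finset.sum_smul]
  rw [Finset.sum_comm]

/-- An algorithm whose field is selected at random among the `F j` is a perturbed Euler scheme for
the averaged field. Over a block on which the iterates stay near `z`, the selected fields are close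
to `F (sel r) z`, and the weighted selections average out by the hypothesis `hsel`. -/
theorem isPerturbedEuler_of_selection [ProperSpace E] [DecidableEq ι] {a : ℕ → ℝ} {x e D : ℕ → E}
    {F : ι → E → E} {sel : ℕ → ι} {q : ι → ℝ}
    (ha : ∀ k, 0 < a k) (hs : ¬ Summable a) (ha0 : Tendsto a atTop (𝓝 0))
    (hx : ∃ R, ∀ k, ‖x k‖ ≤ R) (hF : ∀ j, Continuous (F j)) (he : Tendsto e atTop (𝓝 0))
    (hstep : ∀ k, x (k + 1) = x k - a k • (F (sel k) (x k) + e k) - a k • D k)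
    (hD : ∀ η > 0, ∃ N, ∀ n m, N ≤ n → n ≤ m → ‖∑ r ∈ Finset.Ico n m, a r • D r‖ ≤ η)
    (hsel : ∀ j, ∀ η > 0, ∃ N, ∀ n m, N ≤ n → n ≤ m →
      |∑ r ∈ Finset.Ico n m, a r * ((if sel r = j then 1 else 0) - q j)| ≤ η) :
    IsPerturbedEuler a (fun k => -(F (sel k) (x k) + e k)) x (fun z => -∑ j, q j • F j z) where
  pos := ha
  not_summable := hs
  tendsto_zero := ha0
  bounded := hx
  bounded_increments := by
    obtain ⟨R, hR⟩ := hx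
    obtain ⟨K, -, hK⟩ := exists_bound_closedBall hF R
    obtain ⟨C, hC⟩ := he.norm.bddAbove_range
    refine ⟨K + C, fun k => ?_⟩
    rw [norm_neg]
    exact norm_add_le_of_le (hK _ _ (hR k)) (hC ⟨k, rfl⟩)
  residual := by
    intro η hη
    obtain ⟨N, hN⟩ := hD η hη
    refine ⟨N, fun n m hn hm => ?_⟩
    have h : x m - x n - ∑ r ∈ Finset.Ico n m, a r • -(F (sel r) (x r) + e r) =
        -∑ r ∈ Finset.Ico n m, a r • D r := by
      rw [← Finset.sum_Ico_sub x hm, ← Finset.sum_sub_distrib, ← Finset.sum_neg_distrib]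
      refine Finset.sum_congr rfl fun r _ => ?_
      rw [hstep r]
      module
    rw [h, norm_neg]
    exact hN n m hn hm
  averaging := by
    intro z ε hε
    have hnear : ∀ᶠ y in 𝓝 z, ∀ j, ‖F j y - F j z‖ < ε / 2 := by
      refine eventually_all.2 fun j => ?_
      have := Metric.tendsto_nhds.1 ((hF j).tendsto z) (ε / 2) (by linarith)
      simpa only [dist_eq_norm] using this
    obtain ⟨δ, hδ, hball⟩ := Metric.eventually_nhds_iff.1 hnear
    refine ⟨δ, hδ, fun η hη => ?_⟩
    set B := ∑ j, ‖F j z‖ with hB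
    have hB0 : 0 ≤ B := Finset.sum_nonneg fun j _ => norm_nonneg _
    obtain ⟨N₁, hN₁⟩ := eventually_atTop.1 (Metric.tendsto_nhds.1 he (ε / 2) (by linarith))
    have hη' : 0 < η / (B + 1) := by positivity
    choose N₂ hN₂ using fun j => hsel j (η / (B + 1)) hη'
    refine ⟨max N₁ (Finset.univ.sup N₂), fun n m hn hm hclose => ?_⟩
    rw [← sum_Ico_eq_clock_sub hm]
    have hsplit : ∑ r ∈ Finset.Ico n m, a r • -(F (sel r) (x r) + e r) -
        (∑ r ∈ Finset.Ico n m, a r) • -∑ j, q j • F j z =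
        -(∑ r ∈ Finset.Ico n m, a r • ((F (sel r) (x r) - F (sel r) z) + e r)) -
        ∑ j, (∑ r ∈ Finset.Ico n m, a r * ((if sel r = j then 1 else 0) - q j)) • F j z := by
      rw [← sum_selected_sub_eq fun j => F j z]
      simp only [smul_neg, smul_add, smul_sub, Finset.sum_neg_distrib, Finset.sum_add_distrib,
        Finset.sum_sub_distrib]
      abel
    rw [hsplit]
    refine (norm_sub_le _ _).trans (add_le_add ?_ ?_)
    · rw [norm_neg, Finset.mul_sum]
      refine norm_sum_le_of_le _ fun r hr => ?_
      rw [norm_smul, Real.norm_of_nonneg (ha r).le, mul_comm]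
      refine mul_le_mul_of_nonneg_right ?_ (ha r).le
      have h1 := hball (by rw [dist_eq_norm]; exact hclose r hr) (sel r)
      have h2 := hN₁ r ((le_max_left _ _).trans (hn.trans (Finset.mem_Ico.1 hr).1))
      rw [dist_zero_right] at h2
      linarith [norm_add_le (F (sel r) (x r) - F (sel r) z) (e r)]
    · calc _ ≤ ∑ j, η / (B + 1) * ‖F j z‖ := by
            refine norm_sum_le_of_le _ fun j _ => ?_
            rw [norm_smul, Real.norm_eq_abs]
            refine mul_le_mul_of_nonneg_right (hN₂ j n m ?_ hm) (norm_nonneg _)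
            exact (Finset.le_sup (Finset.mem_univ j)).trans ((le_max_right _ _).trans hn)
        _ = η / (B + 1) * B := by rw [← Finset.mul_sum]
        _ ≤ η := by
            rw [div_mul_eq_mul_div, div_le_iff₀ (by linarith)]
            nlinarith

end Selection

theorem subvec_add {p : ℕ} (S : Finset (Fin p)) (u w : EuclideanSpace ℝ (Fin p)) :
    subvec S (u + w) = subvec S u + subvec S w := by
  ext i
  simp only [subvec, PiLp.add_apply]
  split_ifs <;> simp

theorem continuous_subvec {p : ℕ} (S : Finset (Fin p)) : Continuous (subvec S) := by
  refine (PiLp.continuous_toLp 2 _).comp (continuous_pi fun i => ?_)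
  split_ifs <;> fun_prop

theorem usageCount_le {Ω : Type*} {d : ℕ} (sel : ℕ → Ω → Fin d) (i : Fin d) (k : ℕ) (ω : Ω) :
    usageCount sel i k ω ≤ k :=
  (Finset.card_filter_le _ _).trans (Finset.card_range k).le

end RandomizedSA

theorem mainTheorem4
    {Ω : Type*} [MeasurableSpace Ω] (P : Measure Ω) [IsProbabilityMeasure P]
    (p d : ℕ)
    -- the index sets of the `d` disjoint subvectors
    (S : Fin d → Finset (Fin p))
    (hS_cover : ∀ i, ∃ j, i ∈ S j)
    (hS_disj : ∀ j j', j ≠ j' → Disjoint (S j) (S j'))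
    -- independent random selection with probabilities `q`
    (q : Fin d → ℝ) (hq_pos : ∀ j, 0 < q j) (hq_sum : ∑ j, q j = 1)
    (sel : ℕ → Ω → Fin d) (hsel_meas : ∀ k, Measurable (sel k))
    (hsel_law : ∀ k j, P.real {ω | sel k ω = j} = q j)
    (hsel_indep : iIndepFun sel P)
    -- gain sequences, gradient, its noisy estimates, and the algorithm
    (a : ℕ → ℝ) (aj : Fin d → ℕ → ℝ) (ρ : Fin d → ℝ → ℝ)
    (g : EuclideanSpace ℝ (Fin p) → EuclideanSpace ℝ (Fin p))
    (ghat β ξ : ℕ → Ω → EuclideanSpace ℝ (Fin p) → EuclideanSpace ℝ (Fin p))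
    (θ : ℕ → Ω → EuclideanSpace ℝ (Fin p))
    (θ₀ : Ω → EuclideanSpace ℝ (Fin p))
    (hθ : θ = RandomizedSA.iter S aj sel ghat θ₀)
    (h_decomp : ∀ k ω, ghat k ω (θ k ω) = g (θ k ω) + β k ω (θ k ω) + ξ k ω (θ k ω))
    -- A0'
    (ha_pos : ∀ k, 0 < a k) (ha_anti : StrictAnti a)
    (ha_sum : ¬ Summable a) (ha_sq : Summable (fun k => a k ^ 2))
    (h_gain : ∀ j, RandomizedSA.GainCondition (q j) a (aj j) (ρ j))
    -- A3'
    (hg : Continuous g)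
    -- A4'
    (h_bdd : ∀ᵐ ω ∂P, ∃ R : ℝ, 0 < R ∧ ∀ k, ‖θ k ω‖ ≤ R)
    -- A5'
    (hβ_bdd : ∀ᵐ ω ∂P, ∃ R : ℝ, 0 < R ∧
      ∀ k, ‖RandomizedSA.subvec (S (sel k ω)) (β k ω (θ k ω))‖ ≤ R)
    (hβ_lim : ∀ᵐ ω ∂P,
      Tendsto (fun k => RandomizedSA.subvec (S (sel k ω)) (β k ω (θ k ω))) atTop (𝓝 0))
    -- A6'
    (D : ℕ → Ω → EuclideanSpace ℝ (Fin p))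
    (hD : ∀ r ω, D r ω = (RandomizedSA.queuedGain aj sel (sel r ω) r ω / a r) •
      RandomizedSA.subvec (S (sel r ω)) (ξ r ω (θ r ω)))
    (h_noise : ∀ ε : ℝ, 0 < ε →
      Tendsto (fun k => P {ω | ENNReal.ofReal ε ≤
        ⨆ m : ℕ, ⨆ _ : k ≤ m, ‖∑ r ∈ Finset.Icc k m, a r • D r ω‖ₑ}) atTop (𝓝 0))
    -- A7'
    (θstar : EuclideanSpace ℝ (Fin p))
    (h_stable : RandomizedSA.LocallyAsymptoticallyStable
      (RandomizedSA.limitField S q ρ g) θstar)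
    -- A8'
    (A : Set (EuclideanSpace ℝ (Fin p))) (hA_compact : IsCompact A)
    (hA_sub : A ⊆ RandomizedSA.domainOfAttraction (RandomizedSA.limitField S q ρ g) θstar)
    (hA_freq : ∀ᵐ ω ∂P, ∃ᶠ k in atTop, θ k ω ∈ A) :
    ∀ᵐ ω ∂P, Tendsto (fun k => θ k ω) atTop (𝓝 θstar) := by
  have ha0 : Tendsto a atTop (𝓝 0) := by
    have := ha_sq.tendsto_atTop_zero.sqrt
    simpa [Real.sqrt_sq (ha_pos _).le] using this
  have hq_le : ∀ j, q j ≤ 1 := fun j => by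
    rw [← hsel_law 0 j]; exact measureReal_le_one
  filter_upwards [h_bdd, hβ_lim, hA_freq, RandomizedSA.ae_block_sum_small h_noise,
    ae_all_iff.2 fun j => RandomizedSA.ae_tendsto_usageCount_div hsel_meas hsel_law hsel_indep j,
    ae_all_iff.2 fun j => RandomizedSA.ae_block_sum_selection_small hsel_meas hsel_law hsel_indep
      ha_pos ha_sq j] with ω ⟨R, _, hR⟩ hβ hA hnoise hcount hblock
  set c : ℕ → ℝ := fun k => RandomizedSA.queuedGain aj sel (sel k ω) k ω with hc
  set b : ℕ → EuclideanSpace ℝ (Fin p) :=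
    fun k => RandomizedSA.subvec (S (sel k ω)) (β k ω (θ k ω)) with hb
  set G : Fin d → EuclideanSpace ℝ (Fin p) → EuclideanSpace ℝ (Fin p) :=
    fun j z => RandomizedSA.subvec (S j) (g z) with hG
  have hGc : ∀ j, Continuous (G j) := fun j => (RandomizedSA.continuous_subvec (S j)).comp hg
  have hratio : Tendsto (fun k => c k / a k - ρ (sel k ω) (q (sel k ω))) atTop (𝓝 0) := by
    refine Metric.tendsto_nhds.2 fun ε hε => ?_
    have hall : ∀ᶠ k in atTop, ∀ j, dist (RandomizedSA.queuedGain aj sel j k ω / a k)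
        (ρ j (q j)) < ε := eventually_all.2 fun j =>
      Metric.tendsto_nhds.1 ((h_gain j).tendsto_queue_ratio ha_pos (hq_pos j) (hq_le j)
        (hcount j) fun k => RandomizedSA.usageCount_le sel j k ω) ε hε
    filter_upwards [hall] with k hk
    rw [dist_zero_right, ← dist_eq_norm]
    exact hk (sel k ω)
  -- The deviation of the increment from `ρ j (q j) • G j` at the selected `j` vanishes.
  have he : Tendsto (fun k => (c k / a k - ρ (sel k ω) (q (sel k ω))) • G (sel k ω) (θ k ω) +
      (c k / a k) • b k) atTop (𝓝 0) := by
    obtain ⟨K, -, hK⟩ := RandomizedSA.exists_bound_closedBall hGc R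
    have h1 : Tendsto (fun k => (c k / a k - ρ (sel k ω) (q (sel k ω))) •
        (G (sel k ω) (θ k ω) + b k)) atTop (𝓝 0) := by
      obtain ⟨C, hC⟩ := hβ.norm.bddAbove_range
      refine hratio.zero_smul_isBoundedUnder_le (isBoundedUnder_of ⟨K + C, fun k => ?_⟩)
      exact norm_add_le_of_le (hK _ _ (hR k)) (hC ⟨k, rfl⟩)
    have h2 : Tendsto (fun k => ρ (sel k ω) (q (sel k ω)) • b k) atTop (𝓝 0) := by
      refine (isBoundedUnder_of ⟨∑ j, ‖ρ j (q j)‖, fun k => ?_⟩).smul_tendsto_zero hβ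
      exact Finset.single_le_sum (f := fun j => ‖ρ j (q j)‖) (fun i _ => norm_nonneg _)
        (Finset.mem_univ (sel k ω))
    have h3 := h1.add h2
    rw [add_zero] at h3
    exact h3.congr fun k => by module
  have hstep : ∀ k, θ (k + 1) ω = θ k ω - a k • (ρ (sel k ω) (q (sel k ω)) • G (sel k ω) (θ k ω) +
      ((c k / a k - ρ (sel k ω) (q (sel k ω))) • G (sel k ω) (θ k ω) + (c k / a k) • b k)) -
      a k • D k ω := by
    intro k
    have h1 : θ (k + 1) ω = θ k ω -
        c k • RandomizedSA.subvec (S (sel k ω)) (ghat k ω (θ k ω)) := by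
      rw [hθ]; rfl
    have h2 : a k * (c k / a k) = c k := mul_div_cancel₀ _ (ha_pos k).ne'
    have h3 : a k • D k ω = c k • RandomizedSA.subvec (S (sel k ω)) (ξ k ω (θ k ω)) := by
      rw [hD, smul_smul]
      exact congrArg (· • _) h2
    rw [h1, h_decomp, RandomizedSA.subvec_add, RandomizedSA.subvec_add, h3, ← add_assoc,
      ← add_smul, add_sub_cancel, ← smul_add, smul_smul, h2]
    change θ k ω - c k • (G (sel k ω) (θ k ω) + b k + _) = _
    module
  have H := RandomizedSA.isPerturbedEuler_of_selection (F := fun j z => ρ j (q j) • G j z)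
    ha_pos ha_sum ha0 ⟨R, hR⟩ (fun j => (hGc j).const_smul (ρ j (q j))) he hstep hnoise hblock
  have hfield : (fun z => -∑ j, q j • ρ j (q j) • G j z) = RandomizedSA.limitField S q ρ g := by
    funext z
    simp only [RandomizedSA.limitField_eq_sum, smul_smul, hG]
  rw [hfield] at H
  exact H.tendsto_of_locallyAsymptoticallyStable h_stable hA_compact hA_sub hA
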